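/- **Theorem (Unextendibility bound on one-shot distillable key).** All systems are finite-dimensional quantum systems; a state is a positive semidefinite operator of unit trace, and a channel is a completely positive trace-preserving linear map. *Definitions.* Let $\rho_{AB}$ be a bipartite state and $\varepsilon\in(0,1)$. - Let $\mathcal F(\rho_{AB})$ be the set of all $\operatorname{Tr}_B[\omega_{ABE}]$, where $E$ is isomorphic to $B$ and $\omega_{ABE}$ is a state with $\operatorname{Tr}_E[\omega_{ABE}]=\rho_{AB}$. The smooth-min unextendible entanglement is $$E^{u,\varepsilon}_{\min}(\rho_{AB}) := \inf_{\sigma_{AB}\in\mathcal F(\rho_{AB})}\tfrac12 D^{\varepsilon}_{\min}(\rho_{AB}\Vert\sigma_{AB}),\qquad D^{\varepsilon}_{\min}(\rho\Vert\sigma):=-\log_2\inf_{0\le\Lambda\le I}\{\operatorname{Tr}[\Lambda\sigma]:\operatorname{Tr}[\Lambda\rho]\ge 1-\varepsilon\},$$ and $J:=2^{-2E^{u,\varepsilon}_{\min}(\rho_{AB})}$. - A one-way LOCC channel from $AB$ to $CD$ is a map $\sum_{x}\mathcal E^x_{A\to C}\otimes\mathcal D^x_{B\to D}$ (finite sum),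 where the $\mathcal E^x$ are completely positive with trace-preserving sum and every $\mathcal D^x$ is a channel. - A bipartite private state holding $\log_2 k$ secret bits, with key systems $A',B'$ of dimension $k$ and shield systems $A'',B''$ of arbitrary finite dimension, is a state $\gamma^k_{A'B'A''B''}=V(\Phi^k_{A'B'}\otimes\tau_{A''B''})V^\dagger$, where $\Phi^k$ is the projector onto $k^{-1/2}\sum_{i=0}^{k-1}|i\rangle|i\rangle$, $\tau$ is an arbitrary state and $V=\sum_{i=0}^{k-1}|i\rangle\langle i|_{A'}\otimes I_{B'}\otimes U^i_{A''B''}$ with unitaries $U^i$. - With the fidelity $F(\rho,\sigma):=\big(\operatorname{Tr}\sqrt{\sqrt\sigma\rho\sqrt\sigma}\big)^2$, the one-shot, one-way distillable key is $$K^{\varepsilon,\to}_D(\rho_{AB}):=\sup\{\log_2 k : F(\mathcal L(\rho_{AB}),\gamma^k_{A'B'A''B''})\ge 1-\varepsilon\},$$ the supremum being over all positive integers $k$, all private states $\gamma^k_{A'B'A''B''}$ holding $\log_2 k$ secret bits, and all one-way LOCC channels $\mathcal L$ from $AB$ to $A'B'A''B''$, where Alice obtains $A'A''$ and Bob obtains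 $B'B''$. *Statement.* Fix $\varepsilon\in(0,1)$ and a bipartite state $\rho_{AB}$. If $$\varepsilon<J\le\frac14+\frac\varepsilon2+\frac{\sqrt{3\varepsilon(1-\varepsilon)}}2,$$ then $$K^{\varepsilon,\to}_D(\rho_{AB})\le\frac12\log_2\!\left[\left(\frac{\sqrt{J(1-J)}+\sqrt{\varepsilon(1-\varepsilon)}}{J-\varepsilon}\right)^2+1\right].$$ If $J>\frac14+\frac\varepsilon2+\frac{\sqrt{3\varepsilon(1-\varepsilon)}}2$, then $K^{\varepsilon,\to}_D(\rho_{AB})=0$. -/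

import Mathlib

noncomputable section

namespace OneWayKey

open scoped ENNReal ComplexOrder MatrixOrder Kronecker

/-! Operators on a finite-dimensional Hilbert space with a fixed orthonormal basis `a` are the
complex matrices indexed by `a`; the tensor product of two systems is indexed by the product. -/

section States

variable {a b c : Type*} [Fintype a] [Fintype b] [Fintype c]

/-- A quantum state: a positive semidefinite operator of unit trace. -/
def IsState (ρ : Matrix a a ℂ) : Prop :=
  ρ.PosSemidef ∧ ρ.trace = 1

/-- The fidelity `F(ρ, σ) = (Tr √(√σ ρ √σ))²`. -/
def fidelity [DecidableEq a] (ρ σ : Matrix a a ℂ) : ℝ :=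
  ((CFC.sqrt (CFC.sqrt σ * ρ * CFC.sqrt σ)).trace.re) ^ 2

/-- The partial trace over the last system of a tripartite system `(A × B) × E`. -/
def traceE (ω : Matrix ((a × b) × c) ((a × b) × c) ℂ) : Matrix (a × b) (a × b) ℂ :=
  Matrix.of fun i j => ∑ e, ω (i, e) (j, e)

/-- The partial trace over the middle system of a tripartite system `(A × B) × E`. -/
def traceB (ω : Matrix ((a × b) × c) ((a × b) × c) ℂ) : Matrix (a × c) (a × c) ℂ :=
  Matrix.of fun i j => ∑ k, ω ((i.1, k), i.2) ((j.1, k), j.2)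

end States

section Channels

variable {a b a' b' : Type*} [Fintype a] [Fintype b] [Fintype a'] [Fintype b']

/-- Complete positivity: for every `n`, applying `Φ` to every block of a positive semidefinite
`n × n` block matrix (that is, applying `id_n ⊗ Φ`) gives a positive semidefinite matrix. -/
def IsCompletelyPositive (Φ : Matrix a a ℂ →ₗ[ℂ] Matrix b b ℂ) : Prop :=
  ∀ (n : ℕ) (M : Matrix (Fin n) (Fin n) (Matrix a a ℂ)),
    (Matrix.comp (Fin n) (Fin n) a a ℂ M).PosSemidef →
      (Matrix.comp (Fin n) (Fin n) b b ℂ (M.map Φ)).PosSemidef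

/-- A linear map that preserves the trace. -/
def IsTracePreserving (Φ : Matrix a a ℂ →ₗ[ℂ] Matrix b b ℂ) : Prop :=
  ∀ X, (Φ X).trace = X.trace

/-- A quantum channel: a completely positive and trace-preserving linear map. -/
def IsChannel (Φ : Matrix a a ℂ →ₗ[ℂ] Matrix b b ℂ) : Prop :=
  IsCompletelyPositive Φ ∧ IsTracePreserving Φ

/-- A quantum instrument: a finite family of completely positive maps whose sum is a channel. -/
def IsInstrument {m : ℕ} (𝓔 : Fin m → Matrix a a ℂ →ₗ[ℂ] Matrix b b ℂ) : Prop :=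
  (∀ x, IsCompletelyPositive (𝓔 x)) ∧ IsTracePreserving (∑ x, 𝓔 x)

/-- The tensor product of two linear maps between matrix algebras, as the linear map
determined by `X ⊗ Y ↦ Φ X ⊗ Ψ Y`. -/
def tensorMap [DecidableEq a] [DecidableEq b] [DecidableEq a'] [DecidableEq b']
    (Φ : Matrix a a ℂ →ₗ[ℂ] Matrix a' a' ℂ) (Ψ : Matrix b b ℂ →ₗ[ℂ] Matrix b' b' ℂ) :
    Matrix (a × b) (a × b) ℂ →ₗ[ℂ] Matrix (a' × b') (a' × b') ℂ :=
  (kroneckerLinearEquiv a' a' b' b' ℂ).toLinearMap ∘ₗ TensorProduct.map Φ Ψ ∘ₗ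
    (kroneckerLinearEquiv a a b b ℂ).symm.toLinearMap

/-- One-way LOCC channels from `AB` to `A'B'`: Alice applies an instrument and sends the outcome
`x` to Bob, who then applies a channel that depends on `x`. -/
def IsOneWayLOCC [DecidableEq a] [DecidableEq b] [DecidableEq a'] [DecidableEq b']
    (L : Matrix (a × b) (a × b) ℂ →ₗ[ℂ] Matrix (a' × b') (a' × b') ℂ) : Prop :=
  ∃ (m : ℕ) (𝓔 : Fin m → Matrix a a ℂ →ₗ[ℂ] Matrix a' a' ℂ)
    (𝓓 : Fin m → Matrix b b ℂ →ₗ[ℂ] Matrix b' b' ℂ),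
    IsInstrument 𝓔 ∧ (∀ x, IsChannel (𝓓 x)) ∧ L = ∑ x, tensorMap (𝓔 x) (𝓓 x)

end Channels

section PrivateStates

/-- The maximally entangled state `Φ^k = |Φ^k⟩⟨Φ^k|` with `|Φ^k⟩ = k^{-1/2} ∑ i, |i⟩|i⟩`. -/
def maxEntangled (k : ℕ) : Matrix (Fin k × Fin k) (Fin k × Fin k) ℂ :=
  Matrix.of fun i j => if i.1 = i.2 ∧ j.1 = j.2 then (k : ℂ)⁻¹ else 0

/-- The twisting unitary `∑ i, |i⟩⟨i|_A ⊗ I_B ⊗ U^i_{A'B'}`; the key systems come first. -/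
def twisting {k m n : ℕ} (U : Fin k → Matrix.unitaryGroup (Fin m × Fin n) ℂ) :
    Matrix ((Fin k × Fin k) × (Fin m × Fin n)) ((Fin k × Fin k) × (Fin m × Fin n)) ℂ :=
  ∑ i, (Matrix.single i i 1 ⊗ₖ (1 : Matrix (Fin k) (Fin k) ℂ)) ⊗ₖ
    (U i : Matrix (Fin m × Fin n) (Fin m × Fin n) ℂ)

/-- Bipartite private states holding `log₂ k` secret bits, with key systems `A, B` of dimension `k`
and shield systems `A', B'` of dimensions `m, n`, in the order `(A × B) × (A' × B')`. -/
def IsPrivateState {k m n : ℕ}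
    (γ : Matrix ((Fin k × Fin k) × (Fin m × Fin n)) ((Fin k × Fin k) × (Fin m × Fin n)) ℂ) :
    Prop :=
  ∃ (τ : Matrix (Fin m × Fin n) (Fin m × Fin n) ℂ)
    (U : Fin k → Matrix.unitaryGroup (Fin m × Fin n) ℂ),
    IsState τ ∧ γ = twisting U * (maxEntangled k ⊗ₖ τ) * (twisting U).conjTranspose

/-- Reordering of systems `(A A')(B B') → (A B)(A' B')`, from the partition between Alice and Bob
to the partition between key and shield. -/
def keyShield {k m n : ℕ}
    (σ : Matrix ((Fin k × Fin m) × (Fin k × Fin n)) ((Fin k × Fin m) × (Fin k × Fin n)) ℂ) :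
    Matrix ((Fin k × Fin k) × (Fin m × Fin n)) ((Fin k × Fin k) × (Fin m × Fin n)) ℂ :=
  Matrix.reindex (Equiv.prodProdProdComm _ _ _ _) (Equiv.prodProdProdComm _ _ _ _) σ

end PrivateStates

section Quantities

variable {a b : Type*} [Fintype a] [Fintype b] [DecidableEq a] [DecidableEq b]

/-- `log₂` on `[0, ∞]`, with values in `[-∞, ∞]`. -/
def elog2 (x : ℝ≥0∞) : EReal := ENNReal.log x / ((Real.log 2 : ℝ) : EReal)

/-- `x ↦ 2 ^ x` on `[-∞, ∞]`, with values in `[0, ∞]`. -/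
def eexp2 (x : EReal) : ℝ≥0∞ := EReal.exp (x * ((Real.log 2 : ℝ) : EReal))

/-- The one-shot, one-way distillable key of a bipartite state: the supremum of `log₂ k` over all
positive integers `k`, all private states holding `log₂ k` secret bits (with shield systems of
arbitrary finite dimensions), and all one-way LOCC channels that turn `ρ` into a state of fidelity
at least `1 - ε` with the private state. -/
def distillableKey (ε : ℝ) (ρ : Matrix (a × b) (a × b) ℂ) : EReal :=
  sSup {r : EReal | ∃ (k m n : ℕ)
    (γ : Matrix ((Fin k × Fin k) × (Fin m × Fin n)) ((Fin k × Fin k) × (Fin m × Fin n)) ℂ)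
    (L : Matrix (a × b) (a × b) ℂ →ₗ[ℂ]
      Matrix ((Fin k × Fin m) × (Fin k × Fin n)) ((Fin k × Fin m) × (Fin k × Fin n)) ℂ),
    0 < k ∧ IsPrivateState γ ∧ IsOneWayLOCC L ∧ 1 - ε ≤ fidelity (keyShield (L ρ)) γ ∧
      r = ((Real.logb 2 k : ℝ) : EReal)}

/-- The smooth min-relative entropy (hypothesis testing relative entropy)
`- log₂ inf {Tr[Λσ] : 0 ≤ Λ ≤ I, Tr[Λρ] ≥ 1 - ε}`. -/
def smoothMinRelEntropy (ε : ℝ) (ρ σ : Matrix a a ℂ) : EReal :=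
  -elog2 (⨅ (Λ : Matrix a a ℂ) (_ : 0 ≤ Λ ∧ Λ ≤ 1 ∧ 1 - ε ≤ (Λ * ρ).trace.re),
    ENNReal.ofReal (Λ * σ).trace.re)

/-- The free states relative to `ρ_AB`: the marginals `Tr_B ω` of the extensions `ω_ABE` of
`ρ_AB`, where `E` is isomorphic to `B`. -/
def freeStates (ρ : Matrix (a × b) (a × b) ℂ) : Set (Matrix (a × b) (a × b) ℂ) :=
  {σ | ∃ ω : Matrix ((a × b) × b) ((a × b) × b) ℂ, IsState ω ∧ traceE ω = ρ ∧ σ = traceB ω}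

/-- The smooth-min unextendible entanglement of a bipartite state. -/
def smoothMinUnextEnt (ε : ℝ) (ρ : Matrix (a × b) (a × b) ℂ) : EReal :=
  ⨅ σ ∈ freeStates ρ, ((1 / 2 : ℝ) : EReal) * smoothMinRelEntropy ε ρ σ

/-- `J = 2 ^ (-2 E)`, where `E` is the smooth-min unextendible entanglement. -/
def Jmin (ε : ℝ) (ρ : Matrix (a × b) (a × b) ℂ) : ℝ :=
  (eexp2 (-(2 * smoothMinUnextEnt ε ρ))).toReal

end Quantities

end OneWayKey

end

noncomputable section

namespace OneWayKey

open scoped ENNReal ComplexOrder MatrixOrder Kronecker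
open Matrix

/-! ### Hilbert–Schmidt geometry and the angle between two projections -/

section HilbertSchmidt

variable {m n r s t : Type*} [Fintype m] [Fintype n] [Fintype r] [Fintype s] [Fintype t]

/-! The bound is a monogamy statement: one key register of Alice cannot be privately correlated with
Bob and with a copy of Bob at the same time. A free state `σ` is the `AE` marginal of an extension
`ω` of `ρ`. Since Alice's message can be copied, Bob's channel can be run on `B` and on `E`, so a
one-way LOCC channel `L` sends `σ` to a free state of `L ρ` (`IsOneWayLOCC.map_freeStates`).

A private state lies in the range of a projection, the privacy test, so `L ρ` passes this test with
probability `p ≥ 1 - ε` (`fidelity_le_trace_mul`). Let `q` be the probability that `L σ` passes. On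
`ABE` the tests of `AB` and of `AE` have overlap `1/k` times a contraction
(`privacyIsometry_overlap`), so their ranges are at an angle of at least `arccos (1/k)`. By the
triangle inequality for angles, `√p √q - √(1-p) √(1-q) ≤ 1/k` (`sqrt_mul_le_add_sqrt_of_overlap`).

The test pulled back through `L` is admissible in the smooth min-relative entropy, and `J` is the
supremum over `σ` of the infimum over tests `Λ` of `Tr[Λσ]`. Hence `√(1-ε) √J - √ε √(1-J) ≤ 1/k`
(`sqrt_mul_Jmin_le`). With `J = cos² α` and `ε = sin² β` this reads `cos (α+β) ≤ 1/k`. If `J > ε`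
the cosine is positive, and `k² ≤ 1 + tan² (α+β)` is the stated bound. Above the threshold `α + β <
π/3`, so `1/k > 1/2` and `k = 1`. -/

theorem trace_conjTranspose_mul_self_re (X : Matrix m n ℂ) :
    (Xᴴ * X).trace.re = ∑ p : n × m, ‖X p.2 p.1‖ ^ 2 := by
  simp only [trace, diag_apply, mul_apply, conjTranspose_apply, Complex.re_sum,
    Fintype.sum_prod_type]
  refine Finset.sum_congr rfl fun i _ => Finset.sum_congr rfl fun j _ => ?_
  rw [← starRingEnd_apply, ← Complex.normSq_eq_conj_mul_self, Complex.ofReal_re,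
    Complex.normSq_eq_norm_sq]

theorem trace_conjTranspose_mul_self_re_nonneg (X : Matrix m n ℂ) :
    0 ≤ (Xᴴ * X).trace.re := by
  rw [trace_conjTranspose_mul_self_re]
  positivity

theorem trace_conjTranspose_mul_self_eq_re (X : Matrix m n ℂ) :
    (Xᴴ * X).trace = (((Xᴴ * X).trace.re : ℝ) : ℂ) := by
  refine (Complex.conj_eq_iff_re.1 ?_).symm
  rw [starRingEnd_apply, ← trace_conjTranspose]
  simp

/-- The Cauchy–Schwarz inequality for the Hilbert–Schmidt inner product. -/
theorem norm_trace_conjTranspose_mul_le (X Y : Matrix m n ℂ) :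
    ‖(Xᴴ * Y).trace‖ ≤ √((Xᴴ * X).trace.re) * √((Yᴴ * Y).trace.re) := by
  rw [← Real.sqrt_mul (trace_conjTranspose_mul_self_re_nonneg X)]
  refine Real.le_sqrt_of_sq_le ?_
  have h : ‖(Xᴴ * Y).trace‖ ≤ ∑ p : n × m, ‖X p.2 p.1‖ * ‖Y p.2 p.1‖ := by
    simp only [trace, diag_apply, mul_apply, conjTranspose_apply]
    rw [← Fintype.sum_prod_type' fun i j => star (X j i) * Y j i]
    refine (norm_sum_le _ _).trans_eq (Finset.sum_congr rfl fun p _ => ?_)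
    simp
  rw [trace_conjTranspose_mul_self_re, trace_conjTranspose_mul_self_re]
  exact (pow_le_pow_left₀ (norm_nonneg _) h 2).trans (Finset.sum_mul_sq_le_sq_mul_sq _ _ _)

theorem trace_mul_mul_conjTranspose (C : Matrix n s ℂ) (Z : Matrix n n ℂ) :
    (C * Cᴴ * (Z * Zᴴ)).trace = ((Cᴴ * Z)ᴴ * (Cᴴ * Z)).trace := by
  rw [← Matrix.mul_assoc, trace_mul_comm]
  simp [Matrix.mul_assoc]

/-- If the overlap of two isometries is `c` times a contraction, the angles between a state and
their ranges add up to at least `arccos c`. -/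
theorem sqrt_mul_le_add_sqrt_of_overlap [DecidableEq s] [DecidableEq t]
    {ω : Matrix n n ℂ} (hω : IsState ω) {A : Matrix n s ℂ} {B : Matrix n t ℂ}
    (hA : Aᴴ * A = 1) (hB : Bᴴ * B = 1) {S : Matrix r s ℂ} {T : Matrix r t ℂ}
    (hS : Sᴴ * S = 1) (hT : Tᴴ * T = 1) {c : ℝ} (hc : 0 ≤ c)
    (hAB : Aᴴ * B = (c : ℂ) • (Sᴴ * T)) {p q : ℝ}
    (hp : (A * Aᴴ * ω).trace.re = p) (hq : (B * Bᴴ * ω).trace.re = q) :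
    0 ≤ p ∧ p ≤ 1 ∧ 0 ≤ q ∧ q ≤ 1 ∧ √p * √q ≤ c + √(1 - p) * √(1 - q) := by
  classical
  obtain ⟨W, hW⟩ := CStarAlgebra.nonneg_iff_eq_star_mul_self.1 (nonneg_iff_posSemidef.2 hω.1)
  -- `Z` plays the role of a purification: it is a unit vector for the Hilbert–Schmidt inner
  -- product, and `A * X`, `B * Y` below are its projections onto the two ranges.
  obtain ⟨Z, rfl⟩ : ∃ Z : Matrix n n ℂ, ω = Z * Zᴴ := ⟨Wᴴ, by simpa [star_eq_conjTranspose] using hW⟩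
  have hZ : (Zᴴ * Z).trace = 1 := by rw [trace_mul_comm]; exact hω.2
  obtain ⟨X, hX⟩ : ∃ X, X = Aᴴ * Z := ⟨_, rfl⟩
  obtain ⟨Y, hY⟩ : ∃ Y, Y = Bᴴ * Z := ⟨_, rfl⟩
  have hX' : Xᴴ = Zᴴ * A := by simp [hX]
  have hY' : Yᴴ = Zᴴ * B := by simp [hY]
  rw [trace_mul_mul_conjTranspose, ← hX] at hp
  rw [trace_mul_mul_conjTranspose, ← hY] at hq
  have hpc : (Xᴴ * X).trace = p := by rw [trace_conjTranspose_mul_self_eq_re, hp]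
  have hqc : (Yᴴ * Y).trace = q := by rw [trace_conjTranspose_mul_self_eq_re, hq]
  have h1 : (Xᴴ * Aᴴ * Z).trace = p := by rw [Matrix.mul_assoc, ← hX, hpc]
  have h2 : (Zᴴ * (A * X)).trace = p := by rw [← Matrix.mul_assoc, ← hX', hpc]
  have h3 : (Yᴴ * Bᴴ * Z).trace = q := by rw [Matrix.mul_assoc, ← hY, hqc]
  have h4 : (Zᴴ * (B * Y)).trace = q := by rw [← Matrix.mul_assoc, ← hY', hqc]
  have hAX : Xᴴ * Aᴴ * (A * X) = Xᴴ * X := by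
    rw [Matrix.mul_assoc, ← Matrix.mul_assoc Aᴴ, hA, Matrix.one_mul]
  have hBY : Yᴴ * Bᴴ * (B * Y) = Yᴴ * Y := by
    rw [Matrix.mul_assoc, ← Matrix.mul_assoc Bᴴ, hB, Matrix.one_mul]
  have hXY : Xᴴ * Aᴴ * (B * Y) = (c : ℂ) • ((S * X)ᴴ * (T * Y)) := by
    rw [Matrix.mul_assoc, ← Matrix.mul_assoc Aᴴ, hAB]
    simp [Matrix.mul_assoc]
  have hSX : (S * X)ᴴ * (S * X) = Xᴴ * X := by
    rw [conjTranspose_mul, Matrix.mul_assoc, ← Matrix.mul_assoc Sᴴ, hS, Matrix.one_mul]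
  have hTY : (T * Y)ᴴ * (T * Y) = Yᴴ * Y := by
    rw [conjTranspose_mul, Matrix.mul_assoc, ← Matrix.mul_assoc Tᴴ, hT, Matrix.one_mul]
  -- Subtracting `p • Z` leaves the component of the projected vector orthogonal to `Z`, of squared
  -- norm `p (1 - p)`; likewise for `q`.
  have hPP : ((A * X - (p : ℂ) • Z)ᴴ * (A * X - (p : ℂ) • Z)).trace.re = p * (1 - p) := by
    have : ((A * X - (p : ℂ) • Z)ᴴ * (A * X - (p : ℂ) • Z)).trace = ((p * (1 - p) : ℝ) : ℂ) := by
      simp only [conjTranspose_sub, conjTranspose_mul, conjTranspose_smul, Matrix.sub_mul,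
        Matrix.mul_sub, hAX, Matrix.smul_mul, Matrix.mul_smul, trace_sub, trace_smul, h1, h2, hpc,
        hZ, smul_eq_mul, RCLike.star_def, Complex.conj_ofReal]
      push_cast; ring
    rw [this, Complex.ofReal_re]
  have hQQ : ((B * Y - (q : ℂ) • Z)ᴴ * (B * Y - (q : ℂ) • Z)).trace.re = q * (1 - q) := by
    have : ((B * Y - (q : ℂ) • Z)ᴴ * (B * Y - (q : ℂ) • Z)).trace = ((q * (1 - q) : ℝ) : ℂ) := by
      simp only [conjTranspose_sub, conjTranspose_mul, conjTranspose_smul, Matrix.sub_mul,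
        Matrix.mul_sub, hBY, Matrix.smul_mul, Matrix.mul_smul, trace_sub, trace_smul, h3, h4, hqc,
        hZ, smul_eq_mul, RCLike.star_def, Complex.conj_ofReal]
      push_cast; ring
    rw [this, Complex.ofReal_re]
  have hPQ : ((A * X - (p : ℂ) • Z)ᴴ * (B * Y - (q : ℂ) • Z)).trace =
      c * ((S * X)ᴴ * (T * Y)).trace - p * q := by
    simp only [conjTranspose_sub, conjTranspose_mul A, conjTranspose_smul,
      Matrix.sub_mul, Matrix.mul_sub, hXY, Matrix.smul_mul, Matrix.mul_smul, trace_sub, trace_smul,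
      h1, h4, hZ, smul_eq_mul, RCLike.star_def, Complex.conj_ofReal]
    ring
  have hp0 : 0 ≤ p := hp ▸ trace_conjTranspose_mul_self_re_nonneg X
  have hq0 : 0 ≤ q := hq ▸ trace_conjTranspose_mul_self_re_nonneg Y
  have hp1 : 0 ≤ p * (1 - p) := hPP ▸ trace_conjTranspose_mul_self_re_nonneg _
  have hq1 : 0 ≤ q * (1 - q) := hQQ ▸ trace_conjTranspose_mul_self_re_nonneg _
  have hp2 : p ≤ 1 := by nlinarith
  have hq2 : q ≤ 1 := by nlinarith
  refine ⟨hp0, hp2, hq0, hq2, ?_⟩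
  -- Cauchy–Schwarz is applied to the projected vectors (`b1`) and to their components orthogonal to
  -- `Z` (`b2`). The triangle inequality `b3` combines them, and a factor `√p √q` is cancelled at
  -- the end.
  have b1 := norm_trace_conjTranspose_mul_le (S * X) (T * Y)
  rw [hSX, hTY, hp, hq] at b1
  have b2 := norm_trace_conjTranspose_mul_le (A * X - (p : ℂ) • Z) (B * Y - (q : ℂ) • Z)
  rw [hPP, hQQ, hPQ, Real.sqrt_mul hp0, Real.sqrt_mul hq0] at b2
  have b3 : p * q ≤ c * ‖((S * X)ᴴ * (T * Y)).trace‖ +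
      ‖c * ((S * X)ᴴ * (T * Y)).trace - (p : ℂ) * q‖ := by
    have e : ((p * q : ℝ) : ℂ) = c * ((S * X)ᴴ * (T * Y)).trace -
        (c * ((S * X)ᴴ * (T * Y)).trace - (p : ℂ) * q) := by push_cast; ring
    have := norm_sub_le (c * ((S * X)ᴴ * (T * Y)).trace)
      (c * ((S * X)ᴴ * (T * Y)).trace - (p : ℂ) * q)
    rw [← e, Complex.norm_real, norm_mul (c : ℂ), Complex.norm_real, Real.norm_of_nonneg hc,
      Real.norm_of_nonneg (mul_nonneg hp0 hq0)] at this
    exact this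
  have b4 := mul_le_mul_of_nonneg_left b1 hc
  have hpp := Real.mul_self_sqrt hp0
  have hqq := Real.mul_self_sqrt hq0
  rcases (mul_nonneg (Real.sqrt_nonneg p) (Real.sqrt_nonneg q)).eq_or_lt with h0 | h0
  · rw [← h0]
    positivity
  · refine le_of_mul_le_mul_left ?_ h0
    have e : √p * √q * (√p * √q) = p * q := by
      rw [mul_mul_mul_comm, hpp, hqq]
    rw [e]
    linarith

end HilbertSchmidt

/-! ### Fidelity and projective tests -/

section Fidelity

variable {n : Type*} [Fintype n] [DecidableEq n]

/-- If `|A|² = Aᴴ A`, there is a contraction `W` with `Tr |A| = Tr (Wᴴ A)`. -/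
theorem exists_contraction_trace_eq {T A : Matrix n n ℂ} (hT : IsSelfAdjoint T)
    (hTA : T * T = Aᴴ * A) :
    ∃ W : Matrix n n ℂ, (1 - W * Wᴴ).PosSemidef ∧ T.trace = (Wᴴ * A).trace := by
  have hfin : (spectrum ℝ T).Finite := Matrix.finite_real_spectrum
  have hcont : ∀ f : ℝ → ℝ, ContinuousOn f (spectrum ℝ T) := fun f => hfin.continuousOn f
  -- Since `0⁻¹ = 0`, `R` is the pseudo-inverse of `T`. Then `A * R` is the partial isometry of the
  -- polar decomposition, and `1 - A R (A R)ᴴ` is a projection.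
  set R := cfc (fun x : ℝ => x⁻¹) T with hR
  have hRs : Rᴴ = R := (cfc_predicate (fun x : ℝ => x⁻¹) T : IsSelfAdjoint R)
  have hRTT : R * (T * T) = T := by
    have h1 : T * T = cfc (fun x : ℝ => x * x) T := by
      rw [cfc_mul _ _ _ (hcont _) (hcont _), cfc_id' ℝ T]
    rw [h1, hR, ← cfc_mul _ _ _ (hcont _) (hcont _)]
    conv_rhs => rw [← cfc_id' ℝ T]
    refine cfc_congr fun x _ => ?_
    by_cases h : x = 0
    · simp [h]
    · field_simp
  have hRR : R * R * T = R := by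
    have h2 : R * R * T = cfc (fun x : ℝ => x⁻¹ * x⁻¹ * x) T := by
      rw [cfc_mul _ _ _ (hcont _) (hcont _), cfc_mul _ _ _ (hcont _) (hcont _), cfc_id' ℝ T]
    rw [h2]
    refine cfc_congr fun x _ => ?_
    by_cases h : x = 0
    · simp [h]
    · field_simp
  have hcomm : T * R = R * T := by
    have h := (cfc_commute_cfc (fun x : ℝ => x) (fun x : ℝ => x⁻¹) T).eq
    rwa [cfc_id' ℝ T] at h
  refine ⟨A * R, ?_, ?_⟩
  · have hE : A * R * (A * R)ᴴ * (A * R * (A * R)ᴴ) = A * R * (A * R)ᴴ := by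
      have : A * R * (A * R)ᴴ * (A * R * (A * R)ᴴ) = A * (R * R * (Aᴴ * A) * R * R) * Aᴴ := by
        simp only [conjTranspose_mul, hRs, Matrix.mul_assoc]
      rw [this, ← hTA]
      have : R * R * (T * T) * R * R = R * R := by
        calc R * R * (T * T) * R * R = R * (R * (T * T)) * R * R := by
              simp only [Matrix.mul_assoc]
          _ = (R * T * R) * R := by rw [hRTT]
          _ = R * (R * T) * R := by rw [Matrix.mul_assoc R T R, hcomm]
          _ = R * R := by rw [← Matrix.mul_assoc, hRR]
      rw [this]
      simp only [conjTranspose_mul, hRs, Matrix.mul_assoc]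
    have : 1 - A * R * (A * R)ᴴ = (1 - A * R * (A * R)ᴴ)ᴴ * (1 - A * R * (A * R)ᴴ) := by
      rw [conjTranspose_sub, conjTranspose_one, conjTranspose_mul (A * R), conjTranspose_conjTranspose,
        Matrix.sub_mul, Matrix.mul_sub, Matrix.mul_sub, hE]
      simp
    rw [this]
    exact posSemidef_conjTranspose_mul_self _
  · rw [conjTranspose_mul, hRs, Matrix.mul_assoc, ← hTA, hRTT]

/-- The fidelity with a state supported in the range of a projection is at most the probability
that the projective test is passed. -/
theorem fidelity_le_trace_mul {ρ γ P : Matrix n n ℂ} (hρ : ρ.PosSemidef) (hγ : IsState γ)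
    (hP : Pᴴ = P) (hPP : P * P = P) (hPγ : P * γ = γ) :
    fidelity ρ γ ≤ (P * ρ).trace.re := by
  have hsq : ∀ M : Matrix n n ℂ, 0 ≤ M → (CFC.sqrt M)ᴴ = CFC.sqrt M := fun M _ =>
    (IsSelfAdjoint.of_nonneg (CFC.sqrt_nonneg M) : IsSelfAdjoint (CFC.sqrt M))
  have hρ0 : 0 ≤ ρ := nonneg_iff_posSemidef.2 hρ
  have hγ0 : 0 ≤ γ := nonneg_iff_posSemidef.2 hγ.1
  obtain ⟨r, hr⟩ : ∃ r, r = CFC.sqrt ρ := ⟨_, rfl⟩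
  obtain ⟨g, hg⟩ : ∃ g, g = CFC.sqrt γ := ⟨_, rfl⟩
  have hrs : rᴴ = r := hr ▸ hsq ρ hρ0
  have hgs : gᴴ = g := hg ▸ hsq γ hγ0
  have hrr : r * r = ρ := hr ▸ CFC.sqrt_mul_sqrt_self ρ hρ0
  have hgg : g * g = γ := hg ▸ CFC.sqrt_mul_sqrt_self γ hγ0
  have hPg : P * g = g := by
    have h : ((1 - P) * g)ᴴᴴ * ((1 - P) * g)ᴴ = 0 := by
      rw [conjTranspose_conjTranspose, conjTranspose_mul, hgs, Matrix.mul_assoc, ← Matrix.mul_assoc g,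
        hgg, ← Matrix.mul_assoc, Matrix.sub_mul, hPγ]
      simp
    have := conjTranspose_mul_self_eq_zero.1 h
    rw [conjTranspose_eq_zero, Matrix.sub_mul, Matrix.one_mul, sub_eq_zero] at this
    exact this.symm
  have hgρ : g * ρ * g = (r * g)ᴴ * (r * g) := by
    rw [conjTranspose_mul, hgs, hrs, ← hrr]
    simp only [Matrix.mul_assoc]
  have h0 : 0 ≤ g * ρ * g := by
    rw [hgρ]
    exact nonneg_iff_posSemidef.2 (posSemidef_conjTranspose_mul_self _)
  obtain ⟨W, hW, hWt⟩ := exists_contraction_trace_eq (T := CFC.sqrt (g * ρ * g)) (A := r * g)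
    (hsq _ h0) (by rw [CFC.sqrt_mul_sqrt_self _ h0, hgρ])
  -- The projection `P` fixes `g`, so it can be moved onto `r * W`. Cauchy–Schwarz against `g`,
  -- which has norm one, then bounds the root fidelity by the norm of `P r W`, and `W Wᴴ ≤ 1`
  -- removes `W`.
  have e1 : (CFC.sqrt (g * ρ * g)).trace = ((P * (r * W))ᴴ * g).trace := by
    rw [hWt, conjTranspose_mul, conjTranspose_mul, hP, hrs, Matrix.mul_assoc _ P, hPg,
      Matrix.mul_assoc]
  have hb := norm_trace_conjTranspose_mul_le (P * (r * W)) g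
  rw [← e1, hgs, hgg, hγ.2, Complex.one_re, Real.sqrt_one, mul_one] at hb
  have hb2 : ((P * (r * W))ᴴ * (P * (r * W))).trace.re ≤ (P * ρ).trace.re := by
    have e2 : ((P * (r * W))ᴴ * (P * (r * W))).trace = (P * r * (W * Wᴴ) * (P * r)ᴴ).trace := by
      rw [trace_mul_comm]
      simp only [conjTranspose_mul, Matrix.mul_assoc]
    have e3 : (P * ρ).trace = (P * r * 1 * (P * r)ᴴ).trace := by
      rw [conjTranspose_mul, hrs, hP, Matrix.mul_one, Matrix.mul_assoc, ← Matrix.mul_assoc r, hrr,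
        ← Matrix.mul_assoc, trace_mul_comm (P * ρ), ← Matrix.mul_assoc, hPP]
    have h3 := (hW.mul_mul_conjTranspose_same (P * r)).trace_nonneg
    rw [Matrix.mul_sub, Matrix.sub_mul, trace_sub, ← e2, ← e3] at h3
    have := (Complex.le_def.1 h3).1
    simp only [Complex.zero_re, Complex.sub_re] at this
    linarith
  unfold fidelity
  rw [← hg]
  calc (CFC.sqrt (g * ρ * g)).trace.re ^ 2 ≤ ‖(CFC.sqrt (g * ρ * g)).trace‖ ^ 2 :=
        sq_le_sq.2 (by simpa using Complex.abs_re_le_norm _)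
    _ ≤ √((P * (r * W))ᴴ * (P * (r * W))).trace.re ^ 2 := pow_le_pow_left₀ (norm_nonneg _) hb 2
    _ = ((P * (r * W))ᴴ * (P * (r * W))).trace.re :=
        Real.sq_sqrt (trace_conjTranspose_mul_self_re_nonneg _)
    _ ≤ _ := hb2

end Fidelity

/-! ### Kraus representations of one-way LOCC channels -/

section Kraus

variable {a b a' b' : Type*} [Fintype a] [Fintype b] [Fintype a'] [Fintype b']

/-- A completely positive map has a Kraus representation. -/
theorem IsCompletelyPositive.exists_kraus [DecidableEq a] {Φ : Matrix a a ℂ →ₗ[ℂ] Matrix b b ℂ}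
    (hΦ : IsCompletelyPositive Φ) :
    ∃ K : a × b → Matrix b a ℂ, ∀ X, Φ X = ∑ r, K r * X * (K r)ᴴ := by
  classical
  let e := Fintype.equivFin a
  -- `M` is the unnormalised maximally entangled projector. Its image under `id ⊗ Φ` is the Choi
  -- matrix; factoring that as `Bᴴ B`, each row of `B` yields a Kraus operator.
  let M : Matrix (Fin (Fintype.card a)) (Fin (Fintype.card a)) (Matrix a a ℂ) :=
    of fun i j => single (e.symm i) (e.symm j) 1
  have hM : (Matrix.comp _ _ a a ℂ M).PosSemidef := by
    convert posSemidef_vecMulVec_self_star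
      (fun p : Fin (Fintype.card a) × a => if e.symm p.1 = p.2 then (1 : ℂ) else 0) using 1
    ext p q
    by_cases h1 : e.symm p.1 = p.2 <;> by_cases h2 : e.symm q.1 = q.2 <;>
      simp [M, vecMulVec_apply, h1, h2]
  obtain ⟨B, hB⟩ := CStarAlgebra.nonneg_iff_eq_star_mul_self.1
    (nonneg_iff_posSemidef.2 (hΦ _ M hM))
  have hB' : ∀ i j k l, Φ (single i j 1) k l =
      ∑ r : a × b, star (B (e r.1, r.2) (e i, k)) * B (e r.1, r.2) (e j, l) := by
    intro i j k l
    have h := congrFun₂ hB (e i, k) (e j, l)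
    simp only [comp_apply, map_apply, M, of_apply, Equiv.symm_apply_apply, star_eq_conjTranspose,
      mul_apply, conjTranspose_apply] at h
    rw [h]
    exact (Equiv.sum_comp (Equiv.prodCongr e (Equiv.refl b))
      (fun r => star (B r (e i, k)) * B r (e j, l))).symm
  refine ⟨fun r => of fun k i => star (B (e r.1, r.2) (e i, k)), fun X => ?_⟩
  ext k l
  have hX : Φ X k l = ∑ i, ∑ j, X i j * Φ (single i j 1) k l := by
    conv_lhs => rw [matrix_eq_sum_single X]
    simp only [map_sum, Matrix.sum_apply]
    refine Finset.sum_congr rfl fun i _ => Finset.sum_congr rfl fun j _ => ?_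
    have : single i j (X i j) = X i j • single i j (1 : ℂ) := by simp
    rw [this, map_smul, Matrix.smul_apply, smul_eq_mul]
  rw [hX]
  simp only [hB', Matrix.sum_apply, mul_apply, of_apply, conjTranspose_apply, star_star,
    Finset.mul_sum, Finset.sum_mul]
  rw [Finset.sum_congr rfl fun i _ => Finset.sum_comm, Finset.sum_comm]
  refine Finset.sum_congr rfl fun r _ => ?_
  rw [Finset.sum_comm]
  refine Finset.sum_congr rfl fun i _ => Finset.sum_congr rfl fun j _ => ?_
  ring

theorem trace_mul_sum_kraus {κ : Type*} [Fintype κ] (K : κ → Matrix b a ℂ) (X : Matrix a a ℂ)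
    (Y : Matrix b b ℂ) :
    (Y * ∑ r, K r * X * (K r)ᴴ).trace = ((∑ r, (K r)ᴴ * Y * K r) * X).trace := by
  simp only [Finset.mul_sum, Finset.sum_mul, trace_sum]
  refine Finset.sum_congr rfl fun r _ => ?_
  rw [← Matrix.mul_assoc, trace_mul_comm]
  simp only [Matrix.mul_assoc]

theorem sum_conjTranspose_mul_self_eq_one [DecidableEq a] {κ : Type*} [Fintype κ]
    {K : κ → Matrix b a ℂ}
    (h : ∀ X : Matrix a a ℂ, (∑ r, K r * X * (K r)ᴴ).trace = X.trace) : ∑ r, (K r)ᴴ * K r = 1 := by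
  classical
  refine Matrix.ext_iff_trace_mul_right.2 fun X => ?_
  have := trace_mul_sum_kraus K X 1
  simp only [Matrix.one_mul, Matrix.mul_one] at this ⊢
  rw [← this, h]

variable [DecidableEq a] [DecidableEq b] [DecidableEq a'] [DecidableEq b']

theorem tensorMap_kronecker (Φ : Matrix a a ℂ →ₗ[ℂ] Matrix a' a' ℂ)
    (Ψ : Matrix b b ℂ →ₗ[ℂ] Matrix b' b' ℂ) (X : Matrix a a ℂ) (Y : Matrix b b ℂ) :
    tensorMap Φ Ψ (X ⊗ₖ Y) = Φ X ⊗ₖ Ψ Y := by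
  have h : ∀ (X : Matrix a a ℂ) (Y : Matrix b b ℂ),
    kroneckerLinearEquiv a a b b ℂ (X ⊗ₜ Y) = X ⊗ₖ Y := fun _ _ => rfl
  have h' : ∀ (X : Matrix a' a' ℂ) (Y : Matrix b' b' ℂ),
    kroneckerLinearEquiv a' a' b' b' ℂ (X ⊗ₜ Y) = X ⊗ₖ Y := fun _ _ => rfl
  simp only [tensorMap, LinearMap.comp_apply, LinearEquiv.coe_coe]
  rw [← h, LinearEquiv.symm_apply_apply, TensorProduct.map_tmul, h']

theorem kronecker_induction {p : Matrix (a × b) (a × b) ℂ → Prop}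
    (hk : ∀ (X : Matrix a a ℂ) (Y : Matrix b b ℂ), p (X ⊗ₖ Y))
    (hadd : ∀ X Y, p X → p Y → p (X + Y)) (X : Matrix (a × b) (a × b) ℂ) : p X := by
  obtain ⟨t, rfl⟩ := (kroneckerLinearEquiv a a b b ℂ).surjective X
  induction t with
  | zero => simpa using hk 0 0
  | tmul x y => exact hk x y
  | add x y hx hy => rw [map_add]; exact hadd _ _ hx hy

theorem tensorMap_kraus {κ μ : Type*} [Fintype κ] [Fintype μ]
    {Φ : Matrix a a ℂ →ₗ[ℂ] Matrix a' a' ℂ} {Ψ : Matrix b b ℂ →ₗ[ℂ] Matrix b' b' ℂ}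
    {K : κ → Matrix a' a ℂ} {M : μ → Matrix b' b ℂ} (hK : ∀ X, Φ X = ∑ r, K r * X * (K r)ᴴ)
    (hM : ∀ X, Ψ X = ∑ r, M r * X * (M r)ᴴ) (X : Matrix (a × b) (a × b) ℂ) :
    tensorMap Φ Ψ X = ∑ i, ∑ j, (K i ⊗ₖ M j) * X * (K i ⊗ₖ M j)ᴴ := by
  induction X using kronecker_induction with
  | hk X Y =>
    rw [tensorMap_kronecker, hK, hM]
    simp only [conjTranspose_kronecker, ← mul_kronecker_mul]
    ext p q
    simp only [kroneckerMap_apply, Matrix.sum_apply, Finset.sum_mul_sum]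
  | hadd X Y hX hY =>
    rw [map_add, hX, hY]
    simp only [Matrix.mul_add, Matrix.add_mul, Finset.sum_add_distrib]

/-- The product form and the message `x` stay visible, because Bob's operators `M x j` must later
act on the extension system as well. -/
theorem IsOneWayLOCC.exists_kraus
    {L : Matrix (a × b) (a × b) ℂ →ₗ[ℂ] Matrix (a' × b') (a' × b') ℂ} (hL : IsOneWayLOCC L) :
    ∃ (m : ℕ) (K : Fin m → a × a' → Matrix a' a ℂ) (M : Fin m → b × b' → Matrix b' b ℂ),
      ∑ x, ∑ i, (K x i)ᴴ * K x i = 1 ∧ (∀ x, ∑ j, (M x j)ᴴ * M x j = 1) ∧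
      ∀ X, L X = ∑ x, ∑ i, ∑ j, (K x i ⊗ₖ M x j) * X * (K x i ⊗ₖ M x j)ᴴ := by
  obtain ⟨m, 𝓔, 𝓓, ⟨h𝓔, h𝓔'⟩, h𝓓, rfl⟩ := hL
  choose K hK using fun x => (h𝓔 x).exists_kraus
  choose M hM using fun x => (h𝓓 x).1.exists_kraus
  refine ⟨m, K, M, ?_, fun x => ?_, fun X => ?_⟩
  · have := sum_conjTranspose_mul_self_eq_one (K := fun p : Fin m × (a × a') => K p.1 p.2) ?_
    · rwa [Fintype.sum_prod_type] at this
    · intro X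
      rw [← h𝓔' X, LinearMap.sum_apply, Fintype.sum_prod_type]
      simp only [hK]
  · refine sum_conjTranspose_mul_self_eq_one fun X => ?_
    rw [← hM, (h𝓓 x).2]
  · rw [LinearMap.sum_apply]
    exact Finset.sum_congr rfl fun x _ => tensorMap_kraus (hK x) (hM x) X

/-- A one-way LOCC channel is a channel, given by a Kraus representation. -/
theorem IsOneWayLOCC.exists_kraus_channel
    {L : Matrix (a × b) (a × b) ℂ →ₗ[ℂ] Matrix (a' × b') (a' × b') ℂ} (hL : IsOneWayLOCC L) :
    ∃ (m : ℕ) (N : Fin m × (a × a') × (b × b') → Matrix (a' × b') (a × b) ℂ),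
      ∑ r, (N r)ᴴ * N r = 1 ∧ ∀ X, L X = ∑ r, N r * X * (N r)ᴴ := by
  obtain ⟨m, K, M, hK, hM, hKM⟩ := hL.exists_kraus
  refine ⟨m, fun r => K r.1 r.2.1 ⊗ₖ M r.1 r.2.2, ?_, fun X => ?_⟩
  · simp only [Fintype.sum_prod_type (f := fun r : Fin m × (a × a') × (b × b') => _),
      Fintype.sum_prod_type (f := fun r : (a × a') × (b × b') => _), conjTranspose_kronecker,
      ← mul_kronecker_mul]
    have : ∀ x i, ∑ j, ((K x i)ᴴ * K x i) ⊗ₖ ((M x j)ᴴ * M x j) = ((K x i)ᴴ * K x i) ⊗ₖ 1 := by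
      intro x i
      rw [← hM x]
      ext p q
      simp only [kroneckerMap_apply, Matrix.sum_apply, Finset.mul_sum]
    simp only [this]
    rw [← one_kronecker_one, ← hK]
    ext p q
    simp only [kroneckerMap_apply, Matrix.sum_apply, Finset.sum_mul]
  · rw [hKM, Fintype.sum_prod_type]
    simp only [Fintype.sum_prod_type (f := fun r : (a × a') × (b × b') => _)]

end Kraus

/-! ### Extensions, their marginals, and monotonicity of free states -/

section Marginals

variable {a b c a' b' c' : Type*} [Fintype a] [Fintype b] [Fintype c] [Fintype a'] [Fintype b']
  [Fintype c']

/-- The exchange of the last two of three systems. -/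
def swapLast (a b c : Type*) : (a × b) × c ≃ (a × c) × b where
  toFun p := ((p.1.1, p.2), p.1.2)
  invFun p := ((p.1.1, p.2), p.1.2)
  left_inv _ := rfl
  right_inv _ := rfl

omit [Fintype a] [Fintype c] in
theorem traceB_eq_traceE_submatrix (ω : Matrix ((a × b) × c) ((a × b) × c) ℂ) :
    traceB ω = traceE (ω.submatrix (swapLast a c b) (swapLast a c b)) := rfl

theorem trace_traceE (ω : Matrix ((a × b) × c) ((a × b) × c) ℂ) :
    (traceE ω).trace = ω.trace := by
  exact (Fintype.sum_prod_type fun p => ω p p).symm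

theorem trace_mul_traceE [DecidableEq c] (Y : Matrix (a × b) (a × b) ℂ)
    (ω : Matrix ((a × b) × c) ((a × b) × c) ℂ) :
    (Y * traceE ω).trace = ((Y ⊗ₖ (1 : Matrix c c ℂ)) * ω).trace := by
  simp only [trace, diag_apply, mul_apply, traceE, of_apply, Finset.mul_sum]
  conv_rhs => rw [Fintype.sum_prod_type]
  refine Finset.sum_congr rfl fun i _ => ?_
  rw [Finset.sum_comm]
  refine Finset.sum_congr rfl fun e _ => ?_
  conv_rhs => rw [Fintype.sum_prod_type]
  simp [kroneckerMap_apply, one_apply]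

/-- A channel on a discarded system cannot be noticed on the others. In the pairing with an
arbitrary `Y`, its operators only enter through `∑ (M l)ᴴ M l = 1`. -/
theorem sum_traceE_kraus [DecidableEq c] {κ : Type*} [Fintype κ]
    (A : Matrix (a' × b') (a × b) ℂ) {M : κ → Matrix c' c ℂ} (hM : ∑ l, (M l)ᴴ * M l = 1)
    (ω : Matrix ((a × b) × c) ((a × b) × c) ℂ) :
    ∑ l, traceE ((A ⊗ₖ M l) * ω * (A ⊗ₖ M l)ᴴ) = A * traceE ω * Aᴴ := by
  classical
  refine Matrix.ext_iff_trace_mul_left.2 fun Y => ?_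
  have h1 : (Y * (A * traceE ω * Aᴴ)).trace = (Aᴴ * Y * A * traceE ω).trace := by
    rw [← Matrix.mul_assoc, trace_mul_comm]
    simp only [Matrix.mul_assoc]
  rw [h1, trace_mul_traceE, Finset.mul_sum, trace_sum]
  have h2 : ∀ l, (Y * traceE ((A ⊗ₖ M l) * ω * (A ⊗ₖ M l)ᴴ)).trace =
      (((Aᴴ * Y * A) ⊗ₖ ((M l)ᴴ * M l)) * ω).trace := by
    intro l
    rw [trace_mul_traceE, ← Matrix.mul_assoc, trace_mul_comm, ← Matrix.mul_assoc,
      ← Matrix.mul_assoc, conjTranspose_kronecker, ← mul_kronecker_mul, ← mul_kronecker_mul,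
      Matrix.mul_one]
  simp only [h2]
  rw [← trace_sum, ← Finset.sum_mul, ← hM]
  congr 2
  ext p q
  simp only [kroneckerMap_apply, Matrix.sum_apply, Finset.mul_sum]

omit [Fintype a] [Fintype b] [Fintype c] [Fintype a'] [Fintype b'] [Fintype c'] in
theorem kronecker_submatrix_swapLast (A : Matrix a' a ℂ) (M : Matrix b' b ℂ) (N : Matrix c' c ℂ) :
    ((A ⊗ₖ M) ⊗ₖ N).submatrix (swapLast a' c' b') (swapLast a c b) = (A ⊗ₖ N) ⊗ₖ M := by
  ext p q
  simp only [submatrix_apply, kroneckerMap_apply, swapLast, Equiv.coe_fn_mk]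
  ring

omit [Fintype a] [Fintype b] in
theorem traceE_sum {κ : Type*} (s : Finset κ) (f : κ → Matrix ((a × b) × c) ((a × b) × c) ℂ) :
    traceE (∑ i ∈ s, f i) = ∑ i ∈ s, traceE (f i) := by
  ext p q
  simp only [traceE, of_apply, Matrix.sum_apply]
  rw [Finset.sum_comm]

omit [Fintype a] [Fintype c] in
theorem traceB_sum {κ : Type*} (s : Finset κ) (f : κ → Matrix ((a × b) × c) ((a × b) × c) ℂ) :
    traceB (∑ i ∈ s, f i) = ∑ i ∈ s, traceB (f i) := by
  ext p q
  simp only [traceB, of_apply, Matrix.sum_apply]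
  rw [Finset.sum_comm]

theorem sum_traceB_kraus [DecidableEq b] {κ : Type*} [Fintype κ]
    (A : Matrix a' a ℂ) (N : Matrix c' c ℂ) {M : κ → Matrix b' b ℂ}
    (hM : ∑ l, (M l)ᴴ * M l = 1) (ω : Matrix ((a × b) × c) ((a × b) × c) ℂ) :
    ∑ l, traceB (((A ⊗ₖ M l) ⊗ₖ N) * ω * ((A ⊗ₖ M l) ⊗ₖ N)ᴴ) =
      (A ⊗ₖ N) * traceB ω * (A ⊗ₖ N)ᴴ := by
  rw [traceB_eq_traceE_submatrix ω, ← sum_traceE_kraus _ hM]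
  refine Finset.sum_congr rfl fun l _ => ?_
  rw [traceB_eq_traceE_submatrix, ← submatrix_mul_equiv _ _ _ (swapLast a c b),
    ← submatrix_mul_equiv _ _ _ (swapLast a c b), ← conjTranspose_submatrix,
    kronecker_submatrix_swapLast]

variable [DecidableEq a] [DecidableEq b] [DecidableEq a'] [DecidableEq b']

/-- One-way LOCC channels map free states to free states: Bob's channel is applied to both
systems of the extension. -/
theorem IsOneWayLOCC.map_freeStates
    {L : Matrix (a × b) (a × b) ℂ →ₗ[ℂ] Matrix (a' × b') (a' × b') ℂ} (hL : IsOneWayLOCC L)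
    {ρ σ : Matrix (a × b) (a × b) ℂ} (hσ : σ ∈ freeStates ρ) : L σ ∈ freeStates (L ρ) := by
  obtain ⟨ω, hω, rfl, rfl⟩ := hσ
  obtain ⟨m, K, M, hK, hM, hKM⟩ := hL.exists_kraus
  -- Both copies of Bob receive the same message `x`, but their Kraus indices `j` and `l` are
  -- independent, so discarding either copy leaves the output of `L` on the other marginal.
  set ω' := ∑ x, ∑ i, ∑ j, ∑ l,
    ((K x i ⊗ₖ M x j) ⊗ₖ M x l) * ω * ((K x i ⊗ₖ M x j) ⊗ₖ M x l)ᴴ with hω'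
  have hE : traceE ω' = L (traceE ω) := by
    simp only [hω', traceE_sum, hKM, sum_traceE_kraus _ (hM _)]
  have hB : traceB ω' = L (traceB ω) := by
    simp only [hω', traceB_sum, hKM]
    refine Finset.sum_congr rfl fun x _ => Finset.sum_congr rfl fun i _ => ?_
    rw [Finset.sum_comm]
    simp only [sum_traceB_kraus _ _ (hM _)]
  refine ⟨ω', ⟨?_, ?_⟩, hE, hB.symm⟩
  · refine posSemidef_sum _ fun x _ => posSemidef_sum _ fun i _ => posSemidef_sum _ fun j _ =>
      posSemidef_sum _ fun l _ => hω.1.mul_mul_conjTranspose_same _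
  · obtain ⟨_, N, hN, hLN⟩ := hL.exists_kraus_channel
    rw [← trace_traceE, hE, hLN, ← Matrix.one_mul (∑ r, _), trace_mul_sum_kraus]
    simp only [Matrix.mul_one, hN, Matrix.one_mul, trace_traceE, hω.2]

end Marginals

/-! ### The privacy test and its overlap with a copy of itself -/

section PrivacyTest

variable {k m n : ℕ}

/-- The isometry whose range is the range of the privacy test, from the shield systems `A'B'` to
`(A A')(B B')`: it maps `|ψ⟩` to `k^{-1/2} ∑ i, |i⟩|i⟩ ⊗ U^i|ψ⟩`. -/
def privacyIsometry (U : Fin k → Matrix.unitaryGroup (Fin m × Fin n) ℂ) :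
    Matrix ((Fin k × Fin m) × (Fin k × Fin n)) (Fin m × Fin n) ℂ :=
  Matrix.of fun p u => if p.1.1 = p.2.1 then ((√k : ℝ) : ℂ)⁻¹ * U p.1.1 (p.1.2, p.2.2) u else 0

theorem unitary_sum (V : Matrix.unitaryGroup (Fin m × Fin n) ℂ) (u v : Fin m × Fin n) :
    ∑ s, ∑ t, star (V (s, t) u) * V (s, t) v = if u = v then 1 else 0 := by
  have h := congrFun₂ (Matrix.mem_unitaryGroup_iff'.1 V.2) u v
  rw [star_eq_conjTranspose, mul_apply, Fintype.sum_prod_type, one_apply] at h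
  exact h

theorem inv_sqrt_mul_self (k : ℕ) : ((√k : ℝ) : ℂ)⁻¹ * ((√k : ℝ) : ℂ)⁻¹ = (k : ℂ)⁻¹ := by
  rw [← mul_inv, ← Complex.ofReal_mul, Real.mul_self_sqrt (Nat.cast_nonneg k),
    Complex.ofReal_natCast]

theorem privacyIsometry_isometry (hk : 0 < k) (U : Fin k → Matrix.unitaryGroup (Fin m × Fin n) ℂ) :
    (privacyIsometry U)ᴴ * privacyIsometry U = 1 := by
  ext u v
  have h : ∀ i s j t, star (privacyIsometry U ((i, s), (j, t)) u) * privacyIsometry U ((i, s), (j, t)) v =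
      if i = j then (k : ℂ)⁻¹ * (star (U i (s, t) u) * U i (s, t) v) else 0 := by
    intro i s j t
    by_cases h : i = j
    · subst h
      simp only [privacyIsometry, of_apply, if_true, star_mul', ← inv_sqrt_mul_self]
      simp
      ring
    · simp [privacyIsometry, h]
  rw [mul_apply]
  simp only [Fintype.sum_prod_type, conjTranspose_apply, h]
  have h2 : ∀ i, ∑ s, ∑ j, ∑ t,
      (if i = j then (k : ℂ)⁻¹ * (star (U i (s, t) u) * U i (s, t) v) else 0) =
      (k : ℂ)⁻¹ * if u = v then 1 else 0 := by
    intro i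
    rw [← unitary_sum (U i), Finset.mul_sum]
    refine Finset.sum_congr rfl fun s _ => ?_
    rw [Finset.sum_comm]
    simp [Finset.mul_sum]
  simp only [h2]
  have hk' : (k : ℂ) ≠ 0 := by exact_mod_cast hk.ne'
  simp [one_apply, hk']

theorem twisting_apply (U : Fin k → Matrix.unitaryGroup (Fin m × Fin n) ℂ)
    (p q : (Fin k × Fin k) × (Fin m × Fin n)) :
    twisting U p q = if p.1 = q.1 then U p.1.1 p.2 q.2 else 0 := by
  obtain ⟨⟨i, j⟩, s⟩ := p
  obtain ⟨⟨i', j'⟩, s'⟩ := q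
  simp only [twisting, Matrix.sum_apply, kroneckerMap_apply, single_apply, one_apply, Prod.mk.injEq]
  rw [Finset.sum_eq_single i]
  · by_cases h1 : i = i' <;> by_cases h2 : j = j' <;> simp [h1, h2]
  · intro x _ hx
    simp [hx]
  · simp

/-- A private state is the image of the shield state under the privacy isometry. -/
theorem IsPrivateState.exists_eq
    {γ : Matrix ((Fin k × Fin k) × (Fin m × Fin n)) ((Fin k × Fin k) × (Fin m × Fin n)) ℂ}
    (hγ : IsPrivateState γ) :
    ∃ (τ : Matrix (Fin m × Fin n) (Fin m × Fin n) ℂ)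
      (U : Fin k → Matrix.unitaryGroup (Fin m × Fin n) ℂ), IsState τ ∧
      γ = keyShield (privacyIsometry U * τ * (privacyIsometry U)ᴴ) := by
  obtain ⟨τ, U, hτ, rfl⟩ := hγ
  refine ⟨τ, U, hτ, ?_⟩
  -- `φ` is `|Φ^k⟩ ⊗ I`, which attaches the maximally entangled key to the shield; twisting it gives
  -- the privacy isometry.
  obtain ⟨φ, hφ⟩ : ∃ φ : Matrix ((Fin k × Fin k) × (Fin m × Fin n)) (Fin m × Fin n) ℂ,
    φ = of fun p u => if p.1.1 = p.1.2 then (if p.2 = u then ((√k : ℝ) : ℂ)⁻¹ else 0) else 0 :=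
    ⟨_, rfl⟩
  have h1 : maxEntangled k ⊗ₖ τ = φ * τ * φᴴ := by
    ext ⟨⟨i, j⟩, s⟩ ⟨⟨i', j'⟩, s'⟩
    simp only [hφ, maxEntangled, kroneckerMap_apply, mul_apply, of_apply, conjTranspose_apply]
    by_cases h1 : i = j <;> by_cases h2 : i' = j' <;>
      simp [h1, h2, apply_ite (star : ℂ → ℂ), ← inv_sqrt_mul_self]
    ring
  have h2 : twisting U * φ =
      (privacyIsometry U).submatrix (Equiv.prodProdProdComm _ _ _ _) id := by
    ext ⟨⟨i, j⟩, s⟩ u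
    rw [mul_apply, Fintype.sum_prod_type, Finset.sum_eq_single (i, j)]
    · by_cases h : i = j <;> simp [twisting_apply, hφ, privacyIsometry, h, mul_comm]
    · intro x _ hx
      simp [twisting_apply, hx.symm]
    · simp
  have h3 : twisting U * (φ * τ * φᴴ) * (twisting U)ᴴ = (twisting U * φ) * τ * (twisting U * φ)ᴴ := by
    simp only [conjTranspose_mul, Matrix.mul_assoc]
  rw [h1, h3, h2]
  rfl

theorem keyShield_mul
    (X Y : Matrix ((Fin k × Fin m) × (Fin k × Fin n)) ((Fin k × Fin m) × (Fin k × Fin n)) ℂ) :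
    keyShield X * keyShield Y = keyShield (X * Y) := by
  simp only [keyShield, reindex_apply, submatrix_mul_equiv]

theorem keyShield_trace
    (X : Matrix ((Fin k × Fin m) × (Fin k × Fin n)) ((Fin k × Fin m) × (Fin k × Fin n)) ℂ) :
    (keyShield X).trace = X.trace := by
  simp only [keyShield, reindex_apply, trace, diag_apply, submatrix_apply]
  exact Equiv.sum_comp _ fun p => X p p

theorem keyShield_posSemidef
    {X : Matrix ((Fin k × Fin m) × (Fin k × Fin n)) ((Fin k × Fin m) × (Fin k × Fin n)) ℂ}
    (hX : X.PosSemidef) : (keyShield X).PosSemidef :=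
  hX.submatrix _

/-- A controlled unitary `∑ i, U^i_{A'B'} ⊗ |i⟩⟨i|_E`, with a bystander system `E'`. -/
def controlledFirst (U : Fin k → Matrix.unitaryGroup (Fin m × Fin n) ℂ) :
    Matrix ((Fin k × Fin m) × (Fin n × Fin n)) ((Fin m × Fin n) × (Fin k × Fin n)) ℂ :=
  Matrix.of fun p q => if p.1.1 = q.2.1 ∧ p.2.2 = q.2.2 then U p.1.1 (p.1.2, p.2.1) q.1 else 0

theorem controlledFirst_isometry (U : Fin k → Matrix.unitaryGroup (Fin m × Fin n) ℂ) :
    (controlledFirst U)ᴴ * controlledFirst U = 1 := by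
  ext ⟨u, e, f⟩ ⟨v, e', f'⟩
  rw [mul_apply]
  simp only [Fintype.sum_prod_type, conjTranspose_apply, controlledFirst, of_apply]
  rw [Finset.sum_eq_single e]
  · have : ∀ s t x, star (if x = f then U e (s, t) u else 0) *
        (if e = e' ∧ x = f' then U e (s, t) v else 0) =
        if x = f then (if e = e' ∧ f = f' then star (U e (s, t) u) * U e (s, t) v else 0) else 0 := by
      intro s t x
      by_cases h1 : x = f
      · subst h1
        by_cases h2 : e = e' ∧ x = f' <;> simp [h2]
      · simp [h1]
    simp only [true_and, this, Finset.sum_ite_eq', Finset.mem_univ, if_true]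
    by_cases h : e = e' ∧ f = f'
    · obtain ⟨rfl, rfl⟩ := h
      simpa [one_apply] using unitary_sum (U e) u v
    · simp [one_apply, h]
  · intro x _ hx
    simp [hx]
  · simp

/-- The same operator as `controlledFirst`, with a different order of the systems. -/
theorem controlledFirst_swap_isometry (U : Fin k → Matrix.unitaryGroup (Fin m × Fin n) ℂ) :
    ((controlledFirst U).submatrix (Prod.map id Prod.swap) id)ᴴ *
      (controlledFirst U).submatrix (Prod.map id Prod.swap) id = 1 := by
  rw [conjTranspose_submatrix]
  have := submatrix_mul_equiv (controlledFirst U)ᴴ (controlledFirst U) id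
    (Equiv.prodCongr (Equiv.refl (Fin k × Fin m)) (Equiv.prodComm (Fin n) (Fin n))) id
  rw [controlledFirst_isometry, submatrix_id_id] at this
  exact this

theorem conjTranspose_kronecker_one_mul_swap {x y u : Type*} [Fintype x] [Fintype y]
    [DecidableEq y] (R : Matrix (x × y) u ℂ) (p q : u × y) :
    (((R ⊗ₖ (1 : Matrix y y ℂ)))ᴴ *
      (R ⊗ₖ (1 : Matrix y y ℂ)).submatrix (swapLast x y y) id) p q =
      ∑ i, star (R (i, q.2) p.1) * R (i, p.2) q.1 := by
  simp only [mul_apply, Fintype.sum_prod_type, conjTranspose_apply, kroneckerMap_apply,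
    submatrix_apply, swapLast, Equiv.coe_fn_mk, id, one_apply]
  refine Finset.sum_congr rfl fun i _ => ?_
  rw [Finset.sum_eq_single q.2, Finset.sum_eq_single p.2]
  · simp
  · intro z _ hz
    simp [hz]
  · simp
  · intro z _ hz
    simp [hz]
  · simp

/-- The overlap of the privacy tests on `AB` and on `AE` is `1 / k` times a contraction. -/
theorem privacyIsometry_overlap (U : Fin k → Matrix.unitaryGroup (Fin m × Fin n) ℂ) :
    (privacyIsometry U ⊗ₖ (1 : Matrix (Fin k × Fin n) (Fin k × Fin n) ℂ))ᴴ *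
      (privacyIsometry U ⊗ₖ (1 : Matrix (Fin k × Fin n) (Fin k × Fin n) ℂ)).submatrix
        (swapLast _ _ _) id =
      (((k : ℝ)⁻¹ : ℝ) : ℂ) • ((controlledFirst U)ᴴ *
        (controlledFirst U).submatrix (Prod.map id Prod.swap) id) := by
  ext ⟨u, e, f⟩ ⟨v, b, g⟩
  rw [conjTranspose_kronecker_one_mul_swap, Matrix.smul_apply, mul_apply]
  conv_rhs => rw [Fintype.sum_prod_type, Finset.smul_sum]
  -- Alice's key value `i` must agree with the keys of both copies of Bob. It is therefore fixed,
  -- and the two normalisations `k^{-1/2}` multiply to `1/k` with no sum over `i` to compensate.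
  refine Finset.sum_congr rfl fun ⟨i, s⟩ _ => ?_
  rw [Fintype.sum_prod_type, Finset.sum_eq_single g, Finset.sum_eq_single f]
  · simp only [privacyIsometry, controlledFirst, of_apply, conjTranspose_apply, submatrix_apply,
      Prod.map, Prod.swap, id]
    rcases eq_or_ne i e with rfl | h1
    · rcases eq_or_ne i b with rfl | h2
      · simp [← inv_sqrt_mul_self]
        ring
      · simp [h2]
    · simp [h1]
  · intro z _ hz
    simp [controlledFirst, hz]
  · simp
  · intro z _ hz
    simp [controlledFirst, hz]
  · simp

end PrivacyTest

/-! ### Pulling the privacy test back to the initial state -/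

section Test

variable {a b : Type*} [Fintype a] [Fintype b]

/-- The passing probabilities of the privacy test on the two marginals of an extension. -/
theorem privacyTest_freeStates {k m n : ℕ} (hk : 0 < k)
    (U : Fin k → Matrix.unitaryGroup (Fin m × Fin n) ℂ)
    {ρ σ : Matrix ((Fin k × Fin m) × (Fin k × Fin n)) ((Fin k × Fin m) × (Fin k × Fin n)) ℂ}
    (hσ : σ ∈ freeStates ρ) {p q : ℝ}
    (hp : (privacyIsometry U * (privacyIsometry U)ᴴ * ρ).trace.re = p)
    (hq : (privacyIsometry U * (privacyIsometry U)ᴴ * σ).trace.re = q) :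
    0 ≤ p ∧ p ≤ 1 ∧ 0 ≤ q ∧ q ≤ 1 ∧ √p * √q ≤ (k : ℝ)⁻¹ + √(1 - p) * √(1 - q) := by
  obtain ⟨ω, hω, rfl, rfl⟩ := hσ
  set A := privacyIsometry U ⊗ₖ (1 : Matrix (Fin k × Fin n) (Fin k × Fin n) ℂ) with hA
  have hAA : Aᴴ * A = 1 := by
    rw [hA, conjTranspose_kronecker, ← mul_kronecker_mul, privacyIsometry_isometry hk]
    simp
  have hAA' : A * Aᴴ = (privacyIsometry U * (privacyIsometry U)ᴴ) ⊗ₖ 1 := by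
    rw [hA, conjTranspose_kronecker, ← mul_kronecker_mul]
    simp
  -- The second isometry is the first with `B` and `E` exchanged, so its range is that of the test
  -- on `AE`.
  refine sqrt_mul_le_add_sqrt_of_overlap hω hAA (B := A.submatrix (swapLast _ _ _) id) ?_
    (controlledFirst_isometry U) (controlledFirst_swap_isometry U) (by positivity)
    (privacyIsometry_overlap U) ?_ ?_
  · rw [conjTranspose_submatrix, submatrix_mul_equiv, hAA, submatrix_id_id]
  · rw [hAA', ← trace_mul_traceE, hp]
  · rw [← hq, traceB_eq_traceE_submatrix, trace_mul_traceE, ← hAA']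
    have : A.submatrix (swapLast (Fin k × Fin m) (Fin k × Fin n) (Fin k × Fin n)) id *
        (A.submatrix (swapLast _ _ _) id)ᴴ * ω = (A * Aᴴ * ω.submatrix (swapLast _ _ _)
          (swapLast _ _ _)).submatrix (swapLast _ _ _) (swapLast _ _ _) := by
      rw [conjTranspose_submatrix, ← submatrix_mul_equiv (A * Aᴴ) _ _ (swapLast _ _ _) _,
        ← submatrix_mul_equiv A Aᴴ _ (Equiv.refl _) _]
      rfl
    rw [this]
    congr 1
    exact Equiv.sum_comp (swapLast _ _ _) fun p => (A * Aᴴ * ω.submatrix (swapLast _ _ _)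
          (swapLast _ _ _)) p p

variable [DecidableEq a] [DecidableEq b]

/-- If a one-way LOCC channel takes `ρ` close to a private state, the pullback of the privacy test
tests `ρ` against its free states. -/
theorem exists_test_of_fidelity {k m n : ℕ} (hk : 0 < k) {ε : ℝ}
    {γ : Matrix ((Fin k × Fin k) × (Fin m × Fin n)) ((Fin k × Fin k) × (Fin m × Fin n)) ℂ}
    (hγ : IsPrivateState γ) {L : Matrix (a × b) (a × b) ℂ →ₗ[ℂ]
      Matrix ((Fin k × Fin m) × (Fin k × Fin n)) ((Fin k × Fin m) × (Fin k × Fin n)) ℂ}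
    (hL : IsOneWayLOCC L) {ρ σ : Matrix (a × b) (a × b) ℂ} (hρ : IsState ρ)
    (hF : 1 - ε ≤ fidelity (keyShield (L ρ)) γ) (hσ : σ ∈ freeStates ρ) :
    ∃ Λ : Matrix (a × b) (a × b) ℂ, 0 ≤ Λ ∧ Λ ≤ 1 ∧ 1 - ε ≤ (Λ * ρ).trace.re ∧
      (Λ * ρ).trace.re ≤ 1 ∧ 0 ≤ (Λ * σ).trace.re ∧ (Λ * σ).trace.re ≤ 1 ∧
      √(Λ * ρ).trace.re * √(Λ * σ).trace.re ≤
        (k : ℝ)⁻¹ + √(1 - (Λ * ρ).trace.re) * √(1 - (Λ * σ).trace.re) := by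
  obtain ⟨τ, U, hτ, rfl⟩ := hγ.exists_eq
  obtain ⟨_, N, hN, hLN⟩ := hL.exists_kraus_channel
  set R := privacyIsometry U with hR
  have hRR : Rᴴ * R = 1 := privacyIsometry_isometry hk U
  have hPP : R * Rᴴ * (R * Rᴴ) = R * Rᴴ := by
    rw [Matrix.mul_assoc, ← Matrix.mul_assoc Rᴴ, hRR, Matrix.one_mul]
  have hPH : (R * Rᴴ)ᴴ = R * Rᴴ := by simp
  have hΛ : ∀ X, ((∑ r, (N r)ᴴ * (R * Rᴴ) * N r) * X).trace = (R * Rᴴ * L X).trace := by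
    intro X
    rw [hLN, trace_mul_sum_kraus]
  have hF' : fidelity (keyShield (L ρ)) (keyShield (R * τ * Rᴴ)) ≤ (R * Rᴴ * L ρ).trace.re := by
    rw [← keyShield_trace, ← keyShield_mul]
    refine fidelity_le_trace_mul (keyShield_posSemidef ?_)
      ⟨keyShield_posSemidef (hτ.1.mul_mul_conjTranspose_same _), ?_⟩ ?_ ?_ ?_
    · rw [hLN]
      exact posSemidef_sum _ fun r _ => hρ.1.mul_mul_conjTranspose_same _
    · rw [keyShield_trace, trace_mul_comm, ← Matrix.mul_assoc, hRR, Matrix.one_mul, hτ.2]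
    · exact (keyShield_posSemidef (posSemidef_self_mul_conjTranspose R)).1
    · rw [keyShield_mul, hPP]
    · rw [keyShield_mul, Matrix.mul_assoc R, Matrix.mul_assoc R, ← Matrix.mul_assoc Rᴴ, hRR,
        Matrix.one_mul]
  obtain ⟨h1, h2, h3, h4, h5⟩ := privacyTest_freeStates hk U (hL.map_freeStates hσ) rfl rfl
  refine ⟨∑ r, (N r)ᴴ * (R * Rᴴ) * N r, ?_, ?_, ?_⟩
  · exact nonneg_iff_posSemidef.2 (posSemidef_sum _ fun r _ =>
      (posSemidef_self_mul_conjTranspose R).conjTranspose_mul_mul_same _)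
  · rw [Matrix.le_iff, ← hN, ← Finset.sum_sub_distrib]
    refine posSemidef_sum _ fun r _ => ?_
    have h : (1 - R * Rᴴ).PosSemidef := by
      have : 1 - R * Rᴴ = (1 - R * Rᴴ)ᴴ * (1 - R * Rᴴ) := by
        rw [conjTranspose_sub, conjTranspose_one, hPH, Matrix.sub_mul, Matrix.mul_sub,
          Matrix.mul_sub, hPP]
        simp
      rw [this]
      exact posSemidef_conjTranspose_mul_self _
    have h' := h.conjTranspose_mul_mul_same (N r)
    rwa [Matrix.mul_sub, Matrix.sub_mul, Matrix.mul_one] at h'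
  · simp only [hΛ]
    exact ⟨hF.trans hF', h2, h3, h4, h5⟩

end Test

/-! ### From tests to bounds on `J` -/

section Entropy

theorem elog2_mono : Monotone elog2 := fun _ _ h =>
  EReal.div_le_div_right_of_nonneg (by exact_mod_cast (Real.log_pos one_lt_two).le)
    (ENNReal.log_monotone h)

theorem eexp2_mono : Monotone eexp2 := fun _ _ h =>
  EReal.exp_monotone (mul_le_mul_of_nonneg_right h
    (by exact_mod_cast (Real.log_pos one_lt_two).le))

theorem eexp2_elog2 (x : ℝ≥0∞) : eexp2 (elog2 x) = x := by
  rw [eexp2, elog2, EReal.div_mul_cancel (EReal.coe_ne_bot _) (EReal.coe_ne_top _)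
    (by exact_mod_cast (Real.log_pos one_lt_two).ne'), ENNReal.exp_log]

variable {a b : Type*} [Fintype a] [Fintype b] [DecidableEq a] [DecidableEq b]

/-- Tests of `ρ` against each of its free states bound `Jmin`. -/
theorem Jmin_le {ε t : ℝ} {ρ : Matrix (a × b) (a × b) ℂ} (ht : 0 ≤ t)
    (h : ∀ σ ∈ freeStates ρ, ∃ Λ : Matrix (a × b) (a × b) ℂ,
      0 ≤ Λ ∧ Λ ≤ 1 ∧ 1 - ε ≤ (Λ * ρ).trace.re ∧ (Λ * σ).trace.re ≤ t) : Jmin ε ρ ≤ t := by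
  refine ENNReal.toReal_le_of_le_ofReal ht ?_
  rw [← eexp2_elog2 (ENNReal.ofReal t)]
  refine eexp2_mono ?_
  have h1 : ((1 / 2 : ℝ) : EReal) * -elog2 (ENNReal.ofReal t) ≤ smoothMinUnextEnt ε ρ := by
    refine le_iInf₂ fun σ hσ => mul_le_mul_of_nonneg_left ?_ (by exact_mod_cast (by norm_num))
    obtain ⟨Λ, h0, h1, h2, h3⟩ := h σ hσ
    exact EReal.neg_le_neg_iff.2 (elog2_mono
      ((iInf₂_le Λ ⟨h0, h1, h2⟩).trans (ENNReal.ofReal_le_ofReal h3)))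
  have h2 : (2 : EReal) * (((1 / 2 : ℝ) : EReal) * -elog2 (ENNReal.ofReal t)) =
      -elog2 (ENNReal.ofReal t) := by
    rw [← mul_assoc]
    have : (2 : EReal) * ((1 / 2 : ℝ) : EReal) = 1 := by
      have : (2 : EReal) = ((2 : ℝ) : EReal) := rfl
      rw [this, ← EReal.coe_mul]
      norm_num
    rw [this, one_mul]
  rw [EReal.neg_le, ← h2]
  exact mul_le_mul_of_nonneg_left h1 (by norm_num)

/-- The trivial test `(1 - ε) I` is always admissible. In angles this says `β ≤ α`, which excludes
large `ε` in the threshold case. -/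
theorem Jmin_le_one_sub {ε : ℝ} (hε0 : 0 ≤ ε) (hε1 : ε ≤ 1) {ρ : Matrix (a × b) (a × b) ℂ}
    (hρ : ρ.trace = 1) : Jmin ε ρ ≤ 1 - ε := by
  refine Jmin_le (by linarith) fun σ hσ => ?_
  obtain ⟨ω, hω, -, rfl⟩ := hσ
  have htr : (traceB ω).trace = 1 := by
    rw [traceB_eq_traceE_submatrix, trace_traceE, ← hω.2]
    exact Equiv.sum_comp (swapLast _ _ _) fun p => ω p p
  have h1 : (1 : Matrix (a × b) (a × b) ℂ) - ((1 - ε : ℝ) : ℂ) • 1 = (ε : ℂ) • 1 := by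
    rw [← one_smul ℂ (1 : Matrix (a × b) (a × b) ℂ), smul_smul, mul_one, ← sub_smul]
    simp
  refine ⟨((1 - ε : ℝ) : ℂ) • 1, ?_, ?_, ?_, ?_⟩
  · exact nonneg_iff_posSemidef.2 (PosSemidef.one.smul
      (Complex.zero_le_real.2 (by linarith)))
  · rw [Matrix.le_iff, h1]
    exact PosSemidef.one.smul (Complex.zero_le_real.2 hε0)
  · rw [Matrix.smul_mul, trace_smul, Matrix.one_mul, hρ]; simp
  · rw [Matrix.smul_mul, trace_smul, Matrix.one_mul, htr]; simp

end Entropy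

/-! ### Trigonometry in terms of square roots -/

section RealAnalysis

/-- The bound of the overlap passes from the passing probabilities to their supremum. -/
theorem sqrt_mul_le_of_forall_lt {ε J c : ℝ} (hJ : 0 < J)
    (h : ∀ t, 0 < t → c < √(1 - ε) * √t - √ε * √(1 - t) → J ≤ t) :
    √(1 - ε) * √J - √ε * √(1 - J) ≤ c := by
  by_contra! hc
  have hcont : Continuous fun t : ℝ => √(1 - ε) * √t - √ε * √(1 - t) := by fun_prop
  have h1 : ∀ᶠ t in nhds J, c < √(1 - ε) * √t - √ε * √(1 - t) :=
    hcont.continuousAt.eventually (lt_mem_nhds hc)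
  -- By continuity the strict inequality at `J` persists at some positive `t < J`, which contradicts
  -- the hypothesis.
  obtain ⟨t, ⟨h2, h3⟩, h4⟩ := (((h1.and (lt_mem_nhds hJ)).filter_mono nhdsWithin_le_nhds).and
    (self_mem_nhdsWithin : Set.Iio J ∈ nhdsWithin J (Set.Iio J))).exists
  exact (h t h3 h2).not_gt h4

/-- The expression `√p √q - √(1-p) √(1-q)` is monotone in both `p` and `q`, so `p` may be lowered to
`1 - ε`, and `q > t` would contradict `hc`. -/
theorem le_of_sqrt_mul_le {ε c t p q : ℝ} (hp : 1 - ε ≤ p)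
    (hc : c < √(1 - ε) * √t - √ε * √(1 - t)) (hpq : √p * √q ≤ c + √(1 - p) * √(1 - q)) :
    q ≤ t := by
  by_contra! h
  have h1 : √(1 - ε) ≤ √p := Real.sqrt_le_sqrt hp
  have h2 : √(1 - p) ≤ √ε := Real.sqrt_le_sqrt (by linarith)
  have h3 : √t ≤ √q := Real.sqrt_le_sqrt h.le
  have h4 : √(1 - q) ≤ √(1 - t) := Real.sqrt_le_sqrt (by linarith)
  have h5 : √(1 - ε) * √t ≤ √p * √q := by gcongr
  have h6 : √(1 - p) * √(1 - q) ≤ √ε * √(1 - t) := by gcongr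
  linarith

/-- With `J = cos² α` and `ε = sin² β`, the denominator is `cos (α+β) cos (α-β)` and the numerator
is `sin (α+β) cos (α-β)`. The quotient is `tan (α+β)`, and `1 + tan² = 1 / cos²`. -/
theorem sq_le_of_sqrt_mul_le {ε J k : ℝ} (hε0 : 0 < ε) (hε1 : ε < 1) (hJ : ε < J) (hJ1 : J ≤ 1)
    (hk : 0 < k) (h : √(1 - ε) * √J - √ε * √(1 - J) ≤ k⁻¹) :
    k ^ 2 ≤ ((√(J * (1 - J)) + √(ε * (1 - ε))) / (J - ε)) ^ 2 + 1 := by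
  rw [Real.sqrt_mul (by linarith), Real.sqrt_mul hε0.le]
  have ha : √J ^ 2 = J := Real.sq_sqrt (by linarith)
  have hb : √(1 - J) ^ 2 = 1 - J := Real.sq_sqrt (by linarith)
  have hc : √(1 - ε) ^ 2 = 1 - ε := Real.sq_sqrt (by linarith)
  have hd : √ε ^ 2 = ε := Real.sq_sqrt hε0.le
  have ha0 := Real.sqrt_nonneg J
  have hb0 := Real.sqrt_nonneg (1 - J)
  have hc0 := Real.sqrt_nonneg (1 - ε)
  have hd0 := Real.sqrt_nonneg ε
  generalize √J = x at *
  generalize √(1 - J) = y at *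
  generalize √(1 - ε) = z at *
  generalize √ε = w at *
  have hJe : J - ε = (z * x - w * y) * (z * x + w * y) := by
    have : (z * x - w * y) * (z * x + w * y) = z ^ 2 * x ^ 2 - w ^ 2 * y ^ 2 := by ring
    rw [this, ha, hb, hc, hd]; ring
  have hs : 0 ≤ z * x + w * y := by positivity
  have hprod : 0 < (z * x - w * y) * (z * x + w * y) := by rw [← hJe]; linarith
  have hs' : 0 < z * x + w * y := hs.lt_of_ne fun h0 => by rw [← h0] at hprod; simp at hprod
  have hD : 0 < z * x - w * y := pos_of_mul_pos_left hprod hs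
  have hnum : x * y + w * z = (x * w + y * z) * (z * x + w * y) := by
    have : (x * w + y * z) * (z * x + w * y) =
      (x ^ 2 + y ^ 2) * (w * z) + (z ^ 2 + w ^ 2) * (x * y) := by ring
    rw [this, ha, hb, hc, hd]; ring
  rw [hnum, hJe, mul_div_mul_right _ _ hs'.ne', div_pow]
  have hone : (x * w + y * z) ^ 2 + (z * x - w * y) ^ 2 = 1 := by
    have : (x * w + y * z) ^ 2 + (z * x - w * y) ^ 2 = (x ^ 2 + y ^ 2) * (z ^ 2 + w ^ 2) := by ring
    rw [this, ha, hb, hc, hd]; ring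
  rw [div_add_one (by positivity), hone, ← inv_eq_one_div, ← inv_pow]
  have : k ≤ (z * x - w * y)⁻¹ := (le_inv_comm₀ hD hk).1 h
  gcongr

/-- In the same angles the threshold is `cos² (π/3 - β)`, so the hypothesis means `α < π/3 - β`, and
the conclusion is `cos (α+β) > 1/2`. -/
theorem half_lt_of_threshold_lt {ε J : ℝ} (hε0 : 0 < ε) (hε1 : ε < 1)
    (hJ : 1 / 4 + ε / 2 + √(3 * ε * (1 - ε)) / 2 < J) (hJ1 : J ≤ 1 - ε) :
    1 / 2 < √(1 - ε) * √J - √ε * √(1 - J) := by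
  have hJ0 : 0 < J := lt_trans (by positivity) hJ
  rw [Real.sqrt_mul (by positivity), Real.sqrt_mul (by norm_num)] at hJ
  have h3 : √3 ^ 2 = (3 : ℝ) := Real.sq_sqrt (by norm_num)
  have ha : √J ^ 2 = J := Real.sq_sqrt hJ0.le
  have hb : √(1 - J) ^ 2 = 1 - J := Real.sq_sqrt (by linarith)
  have hc : √(1 - ε) ^ 2 = 1 - ε := Real.sq_sqrt (by linarith)
  have hd : √ε ^ 2 = ε := Real.sq_sqrt hε0.le
  have ht0 : 0 < √(3 : ℝ) := by positivity
  have ht1 : 1 < √(3 : ℝ) := by rw [Real.lt_sqrt] <;> norm_num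
  have ha0 := Real.sqrt_nonneg J
  have hb0 := Real.sqrt_nonneg (1 - J)
  have hc0 : 0 < √(1 - ε) := Real.sqrt_pos.2 (by linarith)
  have hd0 : 0 < √ε := Real.sqrt_pos.2 hε0
  generalize √J = x at *
  generalize √(1 - J) = y at *
  generalize √(1 - ε) = z at *
  generalize √ε = w at *
  generalize √(3 : ℝ) = s at *
  have hx : (z / 2 + s / 2 * w) ^ 2 < x ^ 2 := by
    have : (z / 2 + s / 2 * w) ^ 2 = z ^ 2 / 4 + s ^ 2 * w ^ 2 / 4 + s * w * z / 2 := by ring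
    rw [this, h3, hc, hd, ha]; linarith
  have hx' : z / 2 + s / 2 * w < x := lt_of_pow_lt_pow_left₀ 2 ha0 hx
  have hxz : x ≤ z := by
    refine le_of_not_gt fun h => ?_
    have := pow_lt_pow_left₀ h hc0.le two_ne_zero
    linarith
  -- This is `tan β < 1/√3`, that is `β < π/6`; it makes `sin (π/3 - β)` positive, so that squares
  -- can be compared for `y`.
  have hzw : s * w < z := by linarith
  have hv : 0 < s / 2 * z - w / 2 := by nlinarith
  have hy : y ^ 2 < (s / 2 * z - w / 2) ^ 2 := by
    have : (s / 2 * z - w / 2) ^ 2 = (s ^ 2 + 1) / 4 * (z ^ 2 + w ^ 2) - (z / 2 + s / 2 * w) ^ 2 := by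
      ring
    rw [this, h3, hc, hd, hb]; linarith
  have hy' : y < s / 2 * z - w / 2 := lt_of_pow_lt_pow_left₀ 2 hv.le hy
  have h1 : z * (z / 2 + s / 2 * w) < z * x := mul_lt_mul_of_pos_left hx' hc0
  have h2 : w * y < w * (s / 2 * z - w / 2) := mul_lt_mul_of_pos_left hy' hd0
  -- The addition formula for `β + (π/3 - β)`, whose cosine is `1/2`.
  have h4 : z * (z / 2 + s / 2 * w) - w * (s / 2 * z - w / 2) = (z ^ 2 + w ^ 2) / 2 := by ring
  rw [hc, hd] at h4
  linarith

end RealAnalysis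

/-! ### The trivial key -/

section TrivialKey

variable {a b u v : Type*} [Fintype a] [Fintype b] [Fintype u] [Unique u] [Fintype v] [Unique v]
  [DecidableEq u] [DecidableEq v]

/-- The trace, as a linear map to the operators on a one-dimensional system. -/
def traceChannel (a u : Type*) [Fintype a] [DecidableEq u] :
    Matrix a a ℂ →ₗ[ℂ] Matrix u u ℂ where
  toFun X := X.trace • 1
  map_add' X Y := by rw [trace_add, add_smul]
  map_smul' c X := by rw [trace_smul, smul_assoc, RingHom.id_apply]

theorem traceChannel_isChannel : IsChannel (traceChannel a u) := by
  refine ⟨fun n M hM => ?_, fun X => ?_⟩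
  · have h : Matrix.comp (Fin n) (Fin n) u u ℂ (M.map (traceChannel a u)) =
        ∑ x, (Matrix.comp (Fin n) (Fin n) a a ℂ M).submatrix (fun p : Fin n × u => (p.1, x))
          (fun p : Fin n × u => (p.1, x)) := by
      ext p q
      simp [traceChannel, trace, Matrix.sum_apply, Subsingleton.elim p.2 q.2]
    rw [h]
    exact posSemidef_sum _ fun x _ => hM.submatrix _
  · simp [traceChannel]

variable [DecidableEq a] [DecidableEq b]

omit [Unique u] [Unique v] in
theorem tensorMap_traceChannel (X : Matrix (a × b) (a × b) ℂ) :
    tensorMap (traceChannel a u) (traceChannel b v) X = X.trace • 1 := by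
  induction X using kronecker_induction with
  | hk X Y =>
    rw [tensorMap_kronecker, trace_kronecker]
    simp [traceChannel, smul_kronecker, kronecker_smul, smul_smul, mul_comm]
  | hadd X Y hX hY => rw [map_add, hX, hY, trace_add, add_smul]

theorem traceChannel_isOneWayLOCC :
    IsOneWayLOCC (tensorMap (traceChannel a u) (traceChannel b v)) :=
  ⟨1, fun _ => traceChannel a u, fun _ => traceChannel b v,
    ⟨fun _ => traceChannel_isChannel.1, by simpa using traceChannel_isChannel.2⟩,
    fun _ => traceChannel_isChannel, by simp⟩

theorem fidelity_one_one : fidelity (1 : Matrix u u ℂ) 1 = 1 := by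
  simp [fidelity, CFC.sqrt_one]

/-- Discarding everything produces the unique state of one-dimensional systems, which is a private
state with `k = 1`. The supremum is thus over a set containing `0`, as the equality with `0`
requires. -/
theorem distillableKey_nonneg {ε : ℝ} (hε : 0 ≤ ε) {ρ : Matrix (a × b) (a × b) ℂ}
    (hρ : ρ.trace = 1) : 0 ≤ distillableKey ε ρ := by
  let _ : Unique (Fin 1 × Fin 1) := Unique.mk' _
  let _ : Unique ((Fin 1 × Fin 1) × (Fin 1 × Fin 1)) := Unique.mk' _
  refine le_sSup ⟨1, 1, 1, 1, tensorMap (traceChannel a _) (traceChannel b _), one_pos,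
    ⟨1, fun _ => 1, ⟨PosSemidef.one, by simp⟩, ?_⟩, traceChannel_isOneWayLOCC, ?_, by simp⟩
  · ext p q
    obtain rfl : p = ((0, 0), (0, 0)) := Subsingleton.elim _ _
    obtain rfl : q = ((0, 0), (0, 0)) := Subsingleton.elim _ _
    have h : (default : (Fin 1 × Fin 1) × (Fin 1 × Fin 1)) = ((0, 0), (0, 0)) :=
      Subsingleton.elim _ _
    simp [twisting_apply, mul_apply, maxEntangled, kroneckerMap_apply,
      h]
  · have h : keyShield (tensorMap (traceChannel a (Fin 1 × Fin 1)) (traceChannel b (Fin 1 × Fin 1)) ρ) =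
        1 := by
      rw [tensorMap_traceChannel, hρ, one_smul]
      simp [keyShield]
    rw [h, fidelity_one_one]
    linarith

end TrivialKey

/-! ### The bound on the key size -/

section Bound

variable {a b : Type*} [Fintype a] [Fintype b] [DecidableEq a] [DecidableEq b]

/-- The size of a key that is distilled with error `ε` is bounded in terms of `Jmin`. -/
theorem sqrt_mul_Jmin_le {k m n : ℕ} (hk : 0 < k) {ε : ℝ}
    {γ : Matrix ((Fin k × Fin k) × (Fin m × Fin n)) ((Fin k × Fin k) × (Fin m × Fin n)) ℂ}
    (hγ : IsPrivateState γ) {L : Matrix (a × b) (a × b) ℂ →ₗ[ℂ]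
      Matrix ((Fin k × Fin m) × (Fin k × Fin n)) ((Fin k × Fin m) × (Fin k × Fin n)) ℂ}
    (hL : IsOneWayLOCC L) {ρ : Matrix (a × b) (a × b) ℂ} (hρ : IsState ρ)
    (hF : 1 - ε ≤ fidelity (keyShield (L ρ)) γ) (hJ : 0 < Jmin ε ρ) :
    √(1 - ε) * √(Jmin ε ρ) - √ε * √(1 - Jmin ε ρ) ≤ (k : ℝ)⁻¹ := by
  refine sqrt_mul_le_of_forall_lt hJ fun t ht hc => Jmin_le ht.le fun σ hσ => ?_
  obtain ⟨Λ, h0, h1, h2, -, -, -, h3⟩ := exists_test_of_fidelity hk hγ hL hρ hF hσ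
  exact ⟨Λ, h0, h1, h2, le_of_sqrt_mul_le h2 hc h3⟩

end Bound

end OneWayKey

end

theorem theorem1 {a b : Type*} [Fintype a] [Fintype b] [DecidableEq a] [DecidableEq b]
    (ε : ℝ) (hε : ε ∈ Set.Ioo (0 : ℝ) 1)
    (ρ : Matrix (a × b) (a × b) ℂ) (hρ : OneWayKey.IsState ρ) :
    (OneWayKey.Jmin ε ρ ∈ Set.Ioc ε (1 / 4 + ε / 2 + √(3 * ε * (1 - ε)) / 2) →
      OneWayKey.distillableKey ε ρ ≤
        ((1 / 2 * Real.logb 2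
          (((√(OneWayKey.Jmin ε ρ * (1 - OneWayKey.Jmin ε ρ)) + √(ε * (1 - ε))) /
            (OneWayKey.Jmin ε ρ - ε)) ^ 2 + 1) : ℝ) : EReal)) ∧
    (1 / 4 + ε / 2 + √(3 * ε * (1 - ε)) / 2 < OneWayKey.Jmin ε ρ →
      OneWayKey.distillableKey ε ρ = 0) := by
  obtain ⟨hε0, hε1⟩ := hε
  have hJ1 := OneWayKey.Jmin_le_one_sub hε0.le hε1.le hρ.2
  refine ⟨fun ⟨hJ, _⟩ => sSup_le ?_, fun hJ =>
    le_antisymm (sSup_le ?_) (OneWayKey.distillableKey_nonneg hε0.le hρ.2)⟩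
  · rintro _ ⟨k, m, n, γ, L, hk, hγ, hL, hF, rfl⟩
    have hk' : (0 : ℝ) < k := Nat.cast_pos.2 hk
    have h := OneWayKey.sq_le_of_sqrt_mul_le hε0 hε1 hJ (by linarith) hk'
      (OneWayKey.sqrt_mul_Jmin_le hk hγ hL hρ hF (hε0.trans hJ))
    -- The estimate is for `k ^ 2`; taking logarithms produces the factor `1/2`.
    have h2 := Real.logb_le_logb_of_le one_lt_two (by positivity) h
    rw [Real.logb_pow] at h2
    rw [EReal.coe_le_coe_iff]
    push_cast at h2
    linarith
  · rintro _ ⟨k, m, n, γ, L, hk, hγ, hL, hF, rfl⟩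
    have hJ0 : 0 < OneWayKey.Jmin ε ρ := lt_trans (by positivity) hJ
    have h := (OneWayKey.half_lt_of_threshold_lt hε0 hε1 hJ hJ1).trans_le
      (OneWayKey.sqrt_mul_Jmin_le hk hγ hL hρ hF hJ0)
    have hk2 : (k : ℝ) < 2 := by
      rw [one_div] at h
      exact (inv_lt_inv₀ two_pos (Nat.cast_pos.2 hk)).1 h
    have hk1 : k = 1 := by
      have : k < 2 := by exact_mod_cast hk2
      omega
    simp [hk1]
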